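/- For integers $k,k'\ge 1$ let $\mathcal H_k\subseteq\{0,1\}^{2^k}$ be the Hadamard code, i.e. the set of all vectors $h(w)$, $w\in\{0,1\}^k$, whose $i$-th coordinate ($0\le i\le 2^k-1$) is the inner product modulo 2 of $w$ with the binary encoding of $i$. Put $\delta(r,s)=0$ if $r=s$ and $\delta(r,s)=1$ otherwise. The total function $\mathrm{HEQ}_{k,k'}$ (Hadamard Equality) is defined on all pairs of vectors $\mathbf a=(a_1,\dots,a_{2^k-1})$ (Alice's input) and $\mathbf b=(b_1,\dots,b_{2^k-1})$ (Bob's input) in $\{0,\dots,2^{k'}-1\}^{2^k-1}$ by $$\mathrm{HEQ}_{k,k'}(\mathbf a,\mathbf b)=\begin{cases}0&\text{if }(0,\delta(a_1,b_1),\dots,\delta(a_{2^k-1},b_{2^k-1}))\in\mathcal H_k\setminus\{(0,\dots,0)\},\\1&\text{otherwise.}\end{cases}$$ A nondeterministic protocol for a function $f:X\times Y\to\{0,1\}$ is a deterministic two-party communication protocol in which Alice and Bob receive, besides their inputs $x$ and $y$, a private binary string each (together: the proof), such that if $f(x,y)=1$ then for some proof the output is $1$, and if $f(x,y)=0$ then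 for every proof the output is $0$. Its cost is the maximum, over all inputs and proofs, of the number of bits exchanged, and the nondeterministic communication complexity $N(f)$ is the minimal cost of such a protocol. A quantum weakly nondeterministic protocol for $f$ is a two-party quantum communication protocol without prior entanglement in which the players again receive a private classical string each (the proof), such that if $f(x,y)=1$ then for some proof the output is $1$ with probability $1$, and if $f(x,y)=0$ then for every proof the output is $0$ with probability $1$. The quantum weakly nondeterministic communication complexity $QN(f)$ is the minimal number of qubits exchanged (in the worst case) by such a protocol. **Corollary (quadratic separation).** For every $k\ge1$ both complexities of $\mathrm{HEQ}_{k,2k}$ are finite, and, as $k\to\infty$, $$QN(\mathrm{HEQ}_{k,2k})=O(k),\qquad N(\mathrm{HEQ}_{k,2k})=\Omega(k^2).$$ Consequently $N(\mathrm{HEQ}_{k,2k})=\Omega\big(QN(\mathrm{HEQ}_{k,2k})^2\big)$: there is a quadratic separation, for a total function, of the two complexities. -/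

import Mathlib

open Asymptotics Filter
open scoped Matrix

noncomputable section

/-! ### The function Hadamard Equality -/

/-- The Hadamard code of length `2 ^ k`: the set of the vectors `h(w)`, for `w ∈ {0,1}^k`, whose
`i`-th coordinate is the inner product modulo 2 of `w` with the binary encoding of `i`. -/
def hadamardCode (k : ℕ) : Set (Fin (2 ^ k) → ZMod 2) :=
  Set.range fun (w : Fin k → ZMod 2) (i : Fin (2 ^ k)) =>
    ∑ j : Fin k, w j * (if (i : ℕ).testBit j then 1 else 0)

/-- The inputs of a player: vectors `(a_1, …, a_{2^k - 1})` with entries in `{0, …, 2^k' - 1}`.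
The index set is `{1, …, 2^k - 1}`. -/
abbrev HEQInput (k k' : ℕ) : Type := {i : Fin (2 ^ k) // (i : ℕ) ≠ 0} → Fin (2 ^ k')

/-- The vector `(0, δ(a_1, b_1), …, δ(a_{2^k - 1}, b_{2^k - 1}))`, where `δ(r, s)` is `0` if `r = s`
and `1` otherwise. -/
def deltaVector {k k' : ℕ} (a b : HEQInput k k') : Fin (2 ^ k) → ZMod 2 := fun i =>
  if h : (i : ℕ) = 0 then 0 else if a ⟨i, h⟩ = b ⟨i, h⟩ then 0 else 1

open Classical in
/-- Hadamard Equality. -/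
def HEQ (k k' : ℕ) (a b : HEQInput k k') : Bool :=
  if deltaVector a b ∈ hadamardCode k \ {0} then false else true

/-! ### Classical nondeterministic communication complexity -/

/-- A deterministic two-party communication protocol (a protocol tree), where Alice holds an element
of `U` and Bob an element of `V`. At an inner node one player sends one bit, which may depend on what
this player holds and on all the previous messages (that is, on the node). At a leaf one of the players
produces the output, which may again depend on what this player holds. -/
inductive ClassicalProtocol (U V : Type) : Type
  | outputA (out : U → Bool)
  | outputB (out : V → Bool)
  | sendA (msg : U → Bool) (next : Bool → ClassicalProtocol U V)
  | sendB (msg : V → Bool) (next : Bool → ClassicalProtocol U V)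

namespace ClassicalProtocol

variable {U V : Type}

/-- The output of the protocol. -/
def output : ClassicalProtocol U V → U → V → Bool
  | outputA out, u, _ => out u
  | outputB out, _, v => out v
  | sendA msg next, u, v => (next (msg u)).output u v
  | sendB msg next, u, v => (next (msg v)).output u v

/-- The number of bits exchanged in a run of the protocol. -/
def bits : ClassicalProtocol U V → U → V → ℕ
  | outputA _, _, _ => 0
  | outputB _, _, _ => 0
  | sendA msg next, u, v => (next (msg u)).bits u v + 1
  | sendB msg next, u, v => (next (msg v)).bits u v + 1

end ClassicalProtocol

/-- A nondeterministic protocol: besides the inputs `x : X` and `y : Y`, Alice and Bob each receive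
a private binary string; the pair of these strings is the proof. -/
abbrev NondetProtocol (X Y : Type) : Type := ClassicalProtocol (X × List Bool) (Y × List Bool)

namespace NondetProtocol

variable {X Y : Type}

/-- `P` is a nondeterministic protocol for `f`. -/
def Computes (P : NondetProtocol X Y) (f : X → Y → Bool) : Prop :=
  ∀ x y,
    (f x y = true → ∃ r s : List Bool, P.output (x, r) (y, s) = true) ∧
    (f x y = false → ∀ r s : List Bool, P.output (x, r) (y, s) = false)

/-- The maximum, over all the inputs and all the proofs, of the number of bits exchanged. -/
def cost (P : NondetProtocol X Y) : ℕ∞ :=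
  ⨆ (x : X) (y : Y) (r : List Bool) (s : List Bool), (P.bits (x, r) (y, s) : ℕ∞)

end NondetProtocol

/-- The nondeterministic communication complexity of `f` (`⊤` if no protocol computes `f`). -/
def nondetCC {X Y : Type} (f : X → Y → Bool) : ℕ∞ :=
  ⨅ (P : NondetProtocol X Y) (_ : P.Computes f), P.cost

/-! ### Quantum weakly nondeterministic communication complexity -/

/-- The computational basis of a register of `n` qubits. -/
abbrev QBasis (n : ℕ) : Type := Fin n → Bool

/-- A quantum communication protocol without prior entanglement, at a moment when Alice holds `p`
qubits and Bob holds `q` qubits; `U` and `V` are the types of the classical data of Alice and Bob.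

* `sendA p' m W hW next`: Alice applies the isometry `W u` to her `p` qubits (that is, she adds fresh
  ancillas in state `|0⟩` and applies a unitary), obtains `p' + m` qubits, keeps the first `p'` of them
  and sends the last `m` to Bob, who appends them to his register.
* `outputA P hP`: Alice performs the projective measurement `{P u, 1 - P u}` on her qubits; she outputs
  `1` on the outcome `P u` and `0` on the outcome `1 - P u`.
* `sendB` and `outputB` are the same with the players exchanged.

The schedule of the messages and their lengths are fixed by the protocol. -/
inductive QuantumProtocol (U V : Type) : ℕ → ℕ → Type
  | outputA {p q : ℕ} (P : U → Matrix (QBasis p) (QBasis p) ℂ)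
      (hP : ∀ u, IsStarProjection (P u)) : QuantumProtocol U V p q
  | outputB {p q : ℕ} (P : V → Matrix (QBasis q) (QBasis q) ℂ)
      (hP : ∀ v, IsStarProjection (P v)) : QuantumProtocol U V p q
  | sendA {p q : ℕ} (p' m : ℕ) (W : U → Matrix (QBasis p' × QBasis m) (QBasis p) ℂ)
      (hW : ∀ u, (W u)ᴴ * W u = 1) (next : QuantumProtocol U V p' (q + m)) : QuantumProtocol U V p q
  | sendB {p q : ℕ} (q' m : ℕ) (W : V → Matrix (QBasis q' × QBasis m) (QBasis q) ℂ)
      (hW : ∀ v, (W v)ᴴ * W v = 1) (next : QuantumProtocol U V (p + m) q') : QuantumProtocol U V p q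

namespace QuantumProtocol

variable {U V : Type}

/-- The number of qubits exchanged (it is the same in all the runs). -/
def qubits {p q : ℕ} : QuantumProtocol U V p q → ℕ
  | outputA _ _ => 0
  | outputB _ _ => 0
  | sendA _ m _ _ next => m + next.qubits
  | sendB _ m _ _ next => m + next.qubits

/-- The orthogonal projection of the measurement `{P, 1 - P}` that belongs to the output `o`. -/
def outcome {n : ℕ} (P : Matrix (QBasis n) (QBasis n) ℂ) (o : Bool) :
    Matrix (QBasis n) (QBasis n) ℂ :=
  if o then P else 1 - P

/-- The probability that the protocol outputs `o`, when it is run on the classical data `u` and `v`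
from the pure state `ψ`; the amplitude of `|a⟩|b⟩`, with `a` for Alice's and `b` for Bob's qubits, is
`ψ a b`. -/
def outputProb (o : Bool) (u : U) (v : V) {p q : ℕ} :
    QuantumProtocol U V p q → (QBasis p → QBasis q → ℂ) → ℝ
  | outputA P _, ψ => ∑ a, ∑ b, ‖∑ a', outcome (P u) o a a' * ψ a' b‖ ^ 2
  | outputB P _, ψ => ∑ a, ∑ b, ‖∑ b', outcome (P v) o b b' * ψ a b'‖ ^ 2
  | sendA _ m W _ next, ψ => next.outputProb o u v fun a b =>
      ∑ a', W u (a, fun i => b (Fin.natAdd q i)) a' * ψ a' (fun i => b (Fin.castAdd m i))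
  | sendB _ m W _ next, ψ => next.outputProb o u v fun a b =>
      ∑ b', W v (b, fun i => a (Fin.natAdd p i)) b' * ψ (fun i => a (Fin.castAdd m i)) b'

end QuantumProtocol

/-- A quantum protocol with classical proofs: besides the inputs `x : X` and `y : Y`, Alice and Bob
each receive a private classical binary string. Initially no player holds any qubit. -/
abbrev QuantumProofProtocol (X Y : Type) : Type :=
  QuantumProtocol (X × List Bool) (Y × List Bool) 0 0

namespace QuantumProofProtocol

variable {X Y : Type}

/-- The probability that `P` outputs `o` on the inputs `x`, `y` and the proof `(r, s)`. The state
space of zero qubits is `ℂ`, and the initial state is `1`. -/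
def prob (P : QuantumProofProtocol X Y) (o : Bool) (x : X) (y : Y) (r s : List Bool) : ℝ :=
  P.outputProb o (x, r) (y, s) fun _ _ => 1

/-- `P` is a quantum weakly nondeterministic protocol for `f`. -/
def Computes (P : QuantumProofProtocol X Y) (f : X → Y → Bool) : Prop :=
  ∀ x y,
    (f x y = true → ∃ r s : List Bool, P.prob true x y r s = 1) ∧
    (f x y = false → ∀ r s : List Bool, P.prob false x y r s = 1)

end QuantumProofProtocol

/-- The quantum weakly nondeterministic communication complexity of `f` (`⊤` if no protocol
computes `f`). -/
def quantumWeakNondetCC {X Y : Type} (f : X → Y → Bool) : ℕ∞ :=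
  ⨅ (P : QuantumProofProtocol X Y) (_ : P.Computes f), (P.qubits : ℕ∞)

end

/-! Lower bound. `HEQ` is 1 on the diagonal, so a protocol with `c` bits yields a set `T` of at
least a `2 ^ (-c)` fraction of all inputs with `HEQ = 1` on all of `T × T`
(`ClassicalProtocol.exists_large_rectangle`). Such a set is small (`card_le_of_HEQ_eq_true`), by a
rank argument over `F_2`. The number modulo 2 of codewords equal to the difference vector,
`codewordIndicator`, restricts to the identity matrix on `T × T`. Expanded as a product over the `2
^ k - 1` indices, it is a combination of equality tests on index sets; a set with fewer than `k`
indices left out has coefficient zero, since a polynomial of degree below `k` sums to zero over `F_2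
^ k`. Hence every row is a sum of functions of `2 ^ k - 1 - k` coordinates, which bounds `T.card`.
For entries of `2 * k` bits this saves `2 * k ^ 2` bits, and the number of index sets costs at most
`k ^ 2` of them.

Upper bound. There are two ways for `HEQ` to be 1, and Alice's proof selects which one to test. If
the inputs are equal, Bob's signs leave Alice's superposition of index-entry pairs unchanged; a
nonzero codeword is balanced, so it makes the returned state orthogonal to the original. If the
difference vector is not a codeword, it violates additivity at some `x`, `y`, `x + y`, and three
revealed entries show this. Both tests reject nonzero codewords with certainty
(`HEQProtocol.protocol_computes`). -/

/-! ### Rectangles of classical protocols -/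

/-- A protocol in which at most `c` bits are exchanged splits the inputs on which it accepts into at
most `2 ^ c` rectangles; here the largest one is extracted. -/
theorem ClassicalProtocol.exists_large_rectangle {U V α : Type} (u : α → U) (v : α → V)
    (P : ClassicalProtocol U V) (c : ℕ) (S : Finset α)
    (hS : ∀ p ∈ S, P.output (u p) (v p) = true ∧ P.bits (u p) (v p) ≤ c) :
    ∃ T ⊆ S, S.card ≤ 2 ^ c * T.card ∧ ∀ p ∈ T, ∀ p' ∈ T, P.output (u p) (v p') = true := by
  classical
  induction P generalizing c S with
  | outputA out =>
    exact ⟨S, subset_rfl, Nat.le_mul_of_pos_left _ (by positivity), fun p hp p' _ => (hS p hp).1⟩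
  | outputB out =>
    exact ⟨S, subset_rfl, Nat.le_mul_of_pos_left _ (by positivity), fun p _ p' hp' => (hS p' hp').1⟩
  | sendA msg next ih =>
    rcases c with _ | c
    -- With budget zero `S` is empty, since this node already costs one bit.
    · refine ⟨S, subset_rfl, by simp, fun p hp => ?_⟩
      have := (hS p hp).2
      simp [ClassicalProtocol.bits] at this
    · have key : ∀ b, ∃ T ⊆ S.filter (fun p => msg (u p) = b),
          (S.filter (fun p => msg (u p) = b)).card ≤ 2 ^ c * T.card ∧
          ∀ p ∈ T, ∀ p' ∈ T, (next b).output (u p) (v p') = true := by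
        intro b
        refine ih b c _ fun p hp => ?_
        obtain ⟨hpS, rfl⟩ := Finset.mem_filter.1 hp
        have := hS p hpS
        simp only [ClassicalProtocol.output, ClassicalProtocol.bits] at this
        exact ⟨this.1, by omega⟩
      have hcard := Finset.card_filter_add_card_filter_not (s := S) (fun p => msg (u p) = true)
      simp only [Bool.not_eq_true] at hcard
      obtain ⟨T₁, h₁, hc₁, ho₁⟩ := key true
      obtain ⟨T₀, h₀, hc₀, ho₀⟩ := key false
      -- Keeping the larger of the two rectangles loses a factor of at most 2 for this bit.
      rcases le_total T₀.card T₁.card with h | h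
      · refine ⟨T₁, h₁.trans (Finset.filter_subset _ _), ?_, fun p hp p' hp' => ?_⟩
        · have := Nat.mul_le_mul_left (2 ^ c) h
          rw [pow_succ]; linarith
        · simp only [ClassicalProtocol.output, (Finset.mem_filter.1 (h₁ hp)).2, ho₁ p hp p' hp']
      · refine ⟨T₀, h₀.trans (Finset.filter_subset _ _), ?_, fun p hp p' hp' => ?_⟩
        · have := Nat.mul_le_mul_left (2 ^ c) h
          rw [pow_succ]; linarith
        · simp only [ClassicalProtocol.output, (Finset.mem_filter.1 (h₀ hp)).2, ho₀ p hp p' hp']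
  | sendB msg next ih =>
    rcases c with _ | c
    · refine ⟨S, subset_rfl, by simp, fun p hp => ?_⟩
      have := (hS p hp).2
      simp [ClassicalProtocol.bits] at this
    · have key : ∀ b, ∃ T ⊆ S.filter (fun p => msg (v p) = b),
          (S.filter (fun p => msg (v p) = b)).card ≤ 2 ^ c * T.card ∧
          ∀ p ∈ T, ∀ p' ∈ T, (next b).output (u p) (v p') = true := by
        intro b
        refine ih b c _ fun p hp => ?_
        obtain ⟨hpS, rfl⟩ := Finset.mem_filter.1 hp
        have := hS p hpS
        simp only [ClassicalProtocol.output, ClassicalProtocol.bits] at this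
        exact ⟨this.1, by omega⟩
      have hcard := Finset.card_filter_add_card_filter_not (s := S) (fun p => msg (v p) = true)
      simp only [Bool.not_eq_true] at hcard
      obtain ⟨T₁, h₁, hc₁, ho₁⟩ := key true
      obtain ⟨T₀, h₀, hc₀, ho₀⟩ := key false
      rcases le_total T₀.card T₁.card with h | h
      · refine ⟨T₁, h₁.trans (Finset.filter_subset _ _), ?_, fun p hp p' hp' => ?_⟩
        · have := Nat.mul_le_mul_left (2 ^ c) h
          rw [pow_succ]; linarith
        · simp only [ClassicalProtocol.output, (Finset.mem_filter.1 (h₁ hp')).2, ho₁ p hp p' hp']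
      · refine ⟨T₀, h₀.trans (Finset.filter_subset _ _), ?_, fun p hp p' hp' => ?_⟩
        · have := Nat.mul_le_mul_left (2 ^ c) h
          rw [pow_succ]; linarith
        · simp only [ClassicalProtocol.output, (Finset.mem_filter.1 (h₀ hp')).2, ho₀ p hp p' hp']

/-! ### Finiteness of the classical complexity -/

open Classical in
/-- Alice compares her input with the elements of a list, one after the other, and tells Bob the
results; Bob evaluates `f` once he knows Alice's input. -/
noncomputable def NondetProtocol.search {X Y : Type} (f : X → Y → Bool) :
    List X → NondetProtocol X Y
  | [] => .outputA fun _ => false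
  | x :: l => .sendA (fun u => decide (u.1 = x)) fun b =>
      bif b then .outputB fun v => f x v.1 else search f l

theorem NondetProtocol.search_output {X Y : Type} (f : X → Y → Bool) (l : List X) (x : X) (y : Y)
    (r s : List Bool) (hx : x ∈ l) :
    ClassicalProtocol.output (search f l) (x, r) (y, s) = f x y := by
  induction l with
  | nil => simp at hx
  | cons x' l ih =>
    by_cases h : x = x'
    · simp [search, ClassicalProtocol.output, h]
    · simpa [search, ClassicalProtocol.output, h] using ih (by simpa [h] using hx)

theorem NondetProtocol.search_bits_le {X Y : Type} (f : X → Y → Bool) (l : List X) (x : X) (y : Y)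
    (r s : List Bool) : ClassicalProtocol.bits (search f l) (x, r) (y, s) ≤ l.length := by
  induction l with
  | nil => simp [search, ClassicalProtocol.bits]
  | cons x' l ih =>
    by_cases h : x = x'
    · simp [search, ClassicalProtocol.bits, h]
    · simpa [search, ClassicalProtocol.bits, h] using ih

theorem nondetCC_ne_top {X Y : Type} [Fintype X] (f : X → Y → Bool) : nondetCC f ≠ ⊤ := by
  set P := NondetProtocol.search f (Finset.univ : Finset X).toList with hP
  have hout : P.Computes f := by
    intro x y
    have h : ∀ r s, ClassicalProtocol.output P (x, r) (y, s) = f x y := fun r s =>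
      NondetProtocol.search_output f _ x y r s (by simp)
    exact ⟨fun hf => ⟨[], [], by rw [h, hf]⟩, fun hf r s => by rw [h, hf]⟩
  have hcost : P.cost ≤ ((Finset.univ : Finset X).toList.length : ℕ∞) :=
    iSup_le fun x => iSup_le fun y => iSup_le fun r => iSup_le fun s =>
      Nat.cast_le.2 (NondetProtocol.search_bits_le f _ x y r s)
  exact ne_top_of_le_ne_top (ENat.natCast_ne_top _) ((iInf₂_le P hout).trans hcost)

/-! ### The polynomial method over `F_2` -/

/-- The inner product modulo 2 of `w` with the binary encoding of `i`. -/
def bitInner {k : ℕ} (w : Fin k → ZMod 2) (i : ℕ) : ZMod 2 :=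
  ∑ j : Fin k, w j * (if i.testBit j then 1 else 0)

theorem bitInner_zero {k : ℕ} (w : Fin k → ZMod 2) : bitInner w 0 = 0 := by
  simp [bitInner]

theorem bitInner_two_pow {k : ℕ} (w : Fin k → ZMod 2) (j : Fin k) :
    bitInner w (2 ^ (j : ℕ)) = w j := by
  simp [bitInner, Nat.testBit_two_pow, Fin.val_inj]

theorem mem_hadamardCode_iff {k : ℕ} (d : Fin (2 ^ k) → ZMod 2) :
    d ∈ hadamardCode k ↔ ∃ w : Fin k → ZMod 2, ∀ i : Fin (2 ^ k), bitInner w i = d i := by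
  simp only [hadamardCode, Set.mem_range, funext_iff, bitInner]

theorem HEQ_eq_false_iff {k k' : ℕ} (a b : HEQInput k k') :
    HEQ k k' a b = false ↔ deltaVector a b ∈ hadamardCode k ∧ deltaVector a b ≠ 0 := by
  simp [HEQ]

theorem deltaVector_eq_zero_iff {k k' : ℕ} (a b : HEQInput k k') :
    deltaVector a b = 0 ↔ a = b := by
  constructor
  · intro h
    funext ⟨i, hi⟩
    have := congrFun h i
    by_contra hne
    simp [deltaVector, hi, hne] at this
  · rintro rfl
    funext i
    simp [deltaVector]

/-- Over `F_2`, a product of fewer than `k` linear forms in `k` variables sums to zero. -/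
theorem sum_prod_bitInner_eq_zero {k : ℕ} {ι : Type*} (A : Finset ι) (e : ι → ℕ)
    (hA : A.card < k) : ∑ w : Fin k → ZMod 2, ∏ i ∈ A, bitInner w (e i) = 0 := by
  let L : ι → MvPolynomial (Fin k) (ZMod 2) := fun i =>
    ∑ j : Fin k, MvPolynomial.X j * MvPolynomial.C (if (e i).testBit j then 1 else 0)
  have hL : ∀ i, (L i).totalDegree ≤ 1 := fun i =>
    MvPolynomial.totalDegree_finsetSum_le fun j _ => by
      refine (MvPolynomial.totalDegree_mul _ _).trans ?_
      rw [MvPolynomial.totalDegree_X, MvPolynomial.totalDegree_C]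
  have hdeg : (∏ i ∈ A, L i).totalDegree ≤ A.card :=
    (MvPolynomial.totalDegree_finsetProd A L).trans
      ((Finset.sum_le_sum fun i _ => hL i).trans (by simp))
  -- Each monomial of degree below `k` omits a variable, whose two values contribute equally and
  -- cancel modulo 2.
  have := MvPolynomial.sum_eval_eq_zero (∏ i ∈ A, L i) (by simp [ZMod.card]; omega)
  simpa only [L, map_prod, map_sum, map_mul, MvPolynomial.eval_X, MvPolynomial.eval_C, bitInner]
    using this

/-- The indicator over `F_2` of `δ(a, b)` being a Hadamard codeword, as a sum over the codewords. -/
def codewordIndicator {k k' : ℕ} (a b : HEQInput k k') : ZMod 2 :=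
  ∑ w : Fin k → ZMod 2, ∏ i : {i : Fin (2 ^ k) // (i : ℕ) ≠ 0},
    ((if a i = b i then 1 else 0) + bitInner w (i : Fin (2 ^ k)))

theorem codewordIndicator_self {k k' : ℕ} (a : HEQInput k k') : codewordIndicator a a = 1 := by
  rw [codewordIndicator, Finset.sum_eq_single 0]
  · simp [bitInner]
  · intro w _ hw
    -- The index `2 ^ j` reads off `w j = 1`, so its factor is `1 + 1 = 0`: only the zero codeword
    -- contributes.
    obtain ⟨j, hj⟩ := Function.ne_iff.1 hw
    have hlt : 2 ^ (j : ℕ) < 2 ^ k := Nat.pow_lt_pow_right (by norm_num) j.2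
    refine Finset.prod_eq_zero (Finset.mem_univ ⟨⟨2 ^ (j : ℕ), hlt⟩, by simp⟩) ?_
    rw [bitInner_two_pow]
    simp only [if_true, Pi.zero_apply] at hj ⊢
    generalize w j = t at hj
    revert t; decide
  · simp

theorem codewordIndicator_eq_zero {k k' : ℕ} {a b : HEQInput k k'} (hab : a ≠ b)
    (h : HEQ k k' a b = true) : codewordIndicator a b = 0 := by
  have hd : deltaVector a b ∉ hadamardCode k := fun hmem => by
    have := (HEQ_eq_false_iff a b).2 ⟨hmem, fun h0 => hab ((deltaVector_eq_zero_iff a b).1 h0)⟩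
    rw [h] at this; cases this
  refine Finset.sum_eq_zero fun w _ => ?_
  rw [mem_hadamardCode_iff] at hd
  push Not at hd
  obtain ⟨i, hi⟩ := hd w
  have hi0 : (i : ℕ) ≠ 0 := fun h0 => hi (by simp [deltaVector, h0, bitInner_zero])
  -- The factor at `i` is `1 + δ + bitInner w i`, which vanishes exactly when the codeword and the
  -- difference vector disagree there.
  refine Finset.prod_eq_zero (Finset.mem_univ ⟨i, hi0⟩) ?_
  simp only [deltaVector, hi0, dite_false] at hi
  generalize bitInner w i = t at hi ⊢
  split_ifs at hi ⊢ <;> revert hi <;> revert t <;> decide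

/-- Here `t` is the set of indices at which the equality term is chosen when the product is
multiplied out. This separates the dependence on `w` from that on the inputs. -/
theorem codewordIndicator_eq_sum {k k' : ℕ} (a b : HEQInput k k') :
    codewordIndicator a b =
      ∑ t : Finset {i : Fin (2 ^ k) // (i : ℕ) ≠ 0},
        (∑ w : Fin k → ZMod 2, ∏ i ∈ tᶜ, bitInner w (i : Fin (2 ^ k))) *
          (if ∀ i ∈ t, a i = b i then 1 else 0) := by
  classical
  simp only [codewordIndicator, Finset.prod_add, Finset.powerset_univ]
  rw [Finset.sum_comm]
  refine Finset.sum_congr rfl fun t _ => ?_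
  rw [Finset.sum_mul]
  refine Finset.sum_congr rfl fun w _ => ?_
  rw [mul_comm, ← Finset.compl_eq_univ_sdiff, Finset.prod_ite_zero, Finset.prod_const_one]
  congr

/-- The sums of functions of `m` coordinates. -/
noncomputable def sumOfJuntas {I Q : Type} [Fintype I] (S : Finset (I → Q)) (m : ℕ) :
    ((Σ B : {B : Finset I // B.card = m}, (B.1 → Q)) → ZMod 2) →ₗ[ZMod 2] (S → ZMod 2) where
  toFun F x := ∑ B : {B : Finset I // B.card = m}, F ⟨B, fun i => x.1 i⟩
  map_add' F G := by ext x; simp [Finset.sum_add_distrib]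
  map_smul' c F := by ext x; simp [Finset.mul_sum]

theorem mem_range_sumOfJuntas {I Q : Type} [Fintype I] [DecidableEq I] [DecidableEq Q] (S : Finset (I → Q)) (m : ℕ)
    (hm : m ≤ Fintype.card I) (t : Finset I) (ht : t.card ≤ m) (a : I → Q) :
    (fun x : S => if ∀ i ∈ t, a i = x.1 i then (1 : ZMod 2) else 0) ∈
      LinearMap.range (sumOfJuntas S m) := by
  -- Only the summand of one `m`-set `B ⊇ t` is used; all others are set to zero.
  obtain ⟨B, htB, hB⟩ := Finset.exists_superset_card_eq ht hm
  refine ⟨fun p => if p.1.1 = B then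
    if ∀ i (_ : i ∈ t) (h : i ∈ p.1.1), a i = p.2 ⟨i, h⟩ then 1 else 0 else 0, ?_⟩
  funext x
  simp only [sumOfJuntas, LinearMap.coe_mk, AddHom.coe_mk]
  rw [Finset.sum_eq_single ⟨B, hB⟩]
  · simp only [if_true]
    exact if_congr ⟨fun h i hi => h i hi (htB hi), fun h i hi _ => h i hi⟩ rfl rfl
  · intro B' _ hne
    rw [if_neg fun h => hne (Subtype.ext h)]
  · simp

theorem card_index {k : ℕ} : Fintype.card {i : Fin (2 ^ k) // (i : ℕ) ≠ 0} = 2 ^ k - 1 := by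
  simp

/-- A set of inputs all of whose pairs are mapped to `1` is small. -/
theorem card_le_of_HEQ_eq_true {k k' : ℕ} (S : Finset (HEQInput k k'))
    (hS : ∀ a ∈ S, ∀ b ∈ S, HEQ k k' a b = true) :
    S.card ≤ (2 ^ k - 1).choose (2 ^ k - 1 - k) * (2 ^ k') ^ (2 ^ k - 1 - k) := by
  classical
  have hk : k ≤ 2 ^ k - 1 := Nat.le_sub_one_of_lt Nat.lt_two_pow_self
  set m := 2 ^ k - 1 - k with hm
  -- On `S` the row of `a` in the indicator matrix is the standard basis vector at `a`, so the sums
  -- of juntas span all functions on `S`.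
  have hmem : ∀ a : S, (Pi.single a 1 : S → ZMod 2) ∈ LinearMap.range (sumOfJuntas S m) := by
    intro a
    have : (Pi.single a 1 : S → ZMod 2) = ∑ t : Finset {i : Fin (2 ^ k) // (i : ℕ) ≠ 0},
        (∑ w : Fin k → ZMod 2, ∏ i ∈ tᶜ, bitInner w (i : Fin (2 ^ k))) •
          (fun x : S => if ∀ i ∈ t, a.1 i = x.1 i then (1 : ZMod 2) else 0) := by
      funext b
      simp only [Finset.sum_apply, Pi.smul_apply, smul_eq_mul]
      have hb := codewordIndicator_eq_sum a.1 b.1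
      refine Eq.trans ?_ (hb.trans (Finset.sum_congr rfl fun t _ => by congr))
      by_cases hab : b = a
      · subst hab; simp [codewordIndicator_self]
      · rw [Pi.single_eq_of_ne hab, codewordIndicator_eq_zero
          (fun h => hab (Subtype.ext h.symm)) (hS a a.2 b b.2)]
    rw [this]
    refine Submodule.sum_mem _ fun t _ => ?_
    by_cases ht : t.card ≤ m
    · exact Submodule.smul_mem _ _
        (mem_range_sumOfJuntas S m (by rw [card_index]; omega) t ht a.1)
    -- If `t` has more than `m` elements, fewer than `k` linear forms remain.
    · rw [sum_prod_bitInner_eq_zero, zero_smul]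
      · exact Submodule.zero_mem _
      · have := t.card_le_univ
        rw [card_index] at this
        rw [Finset.card_compl, card_index]; omega
  have hsurj : Function.Surjective (sumOfJuntas S m) := by
    intro g
    rw [← LinearMap.mem_range, pi_eq_sum_univ' g]
    exact Submodule.sum_mem _ fun a _ => Submodule.smul_mem _ _ (hmem a)
  have h := LinearMap.finrank_le_finrank_of_surjective hsurj
  simp only [Module.finrank_fintype_fun_eq_card, Fintype.card_coe, Fintype.card_sigma,
    Fintype.card_fun, Fintype.card_fin] at h
  refine h.trans (le_of_eq ?_)
  rw [Finset.sum_congr rfl fun B _ => by rw [B.2]]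
  simp [Fintype.card_finset_len]

theorem sq_le_nondetCC_HEQ (k : ℕ) : ((k ^ 2 : ℕ) : ℕ∞) ≤ nondetCC (HEQ k (2 * k)) := by
  classical
  refine le_iInf₂ fun P hP => ?_
  rcases eq_or_ne P.cost ⊤ with h | h
  · simp [h]
  obtain ⟨c, hc⟩ := ENat.ne_top_iff_exists.1 h
  rw [← hc, Nat.cast_le]
  have hbits : ∀ x y r s, ClassicalProtocol.bits P (x, r) (y, s) ≤ c := fun x y r s => by
    have : (ClassicalProtocol.bits P (x, r) (y, s) : ℕ∞) ≤ P.cost :=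
      le_iSup_of_le x <| le_iSup_of_le y <| le_iSup_of_le r <| le_iSup_of_le s le_rfl
    rwa [← hc, Nat.cast_le] at this
  have hdiag : ∀ a : HEQInput k (2 * k), HEQ k (2 * k) a a = true := fun a => by
    rw [← Bool.not_eq_false, HEQ_eq_false_iff]
    exact fun h => h.2 ((deltaVector_eq_zero_iff a a).2 rfl)
  -- Each diagonal input gets its own accepting proof. The rectangle mixes Alice's half of one with
  -- Bob's half of another, and soundness turns acceptance into `HEQ = 1` on `T × T`.
  choose r s hrs using fun a => (hP a a).1 (hdiag a)
  obtain ⟨T, -, hT, hout⟩ := ClassicalProtocol.exists_large_rectangle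
    (fun a => (a, r a)) (fun a => (a, s a)) P c Finset.univ
    fun a _ => ⟨hrs a, hbits _ _ _ _⟩
  have hcard := card_le_of_HEQ_eq_true T fun a ha b hb => by
    by_contra hf
    have := (hP a b).2 (by simpa using hf) (r a) (s b)
    rw [hout a ha b hb] at this
    cases this
  have hk : k ≤ 2 ^ k - 1 := Nat.le_sub_one_of_lt Nat.lt_two_pow_self
  have huniv : (Finset.univ : Finset (HEQInput k (2 * k))).card
      = (2 ^ (2 * k)) ^ k * (2 ^ (2 * k)) ^ (2 ^ k - 1 - k) := by
    rw [← pow_add, Nat.add_sub_cancel' hk]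
    simp
  have hchoose : (2 ^ k - 1).choose (2 ^ k - 1 - k) ≤ 2 ^ (k ^ 2) := by
    rw [Nat.choose_symm hk]
    calc _ ≤ (2 ^ k - 1) ^ k := Nat.choose_le_pow _ _
      _ ≤ (2 ^ k) ^ k := Nat.pow_le_pow_left (Nat.sub_le _ _) _
      _ = _ := by rw [← pow_mul, sq]
  -- The entries at `2 ^ k - 1 - k` coordinates cancel, leaving `2 * k ^ 2 ≤ c + k ^ 2`.
  have h1 : (2 ^ (2 * k)) ^ k ≤ 2 ^ c * 2 ^ (k ^ 2) := by
    refine Nat.le_of_mul_le_mul_right (c := (2 ^ (2 * k)) ^ (2 ^ k - 1 - k)) ?_ (by positivity)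
    rw [← huniv, mul_assoc]
    exact hT.trans (Nat.mul_le_mul_left _ (hcard.trans (Nat.mul_le_mul_right _ hchoose)))
  rw [← pow_mul, ← pow_add, Nat.pow_le_pow_iff_right (by norm_num)] at h1
  nlinarith

/-! ### Two-message quantum protocols -/

/-- The basis states of `0 + (n + m)` qubits, as pairs of basis states of `n` and of `m` qubits. -/
def splitQBasis (n m : ℕ) : QBasis (0 + (n + m)) ≃ QBasis n × QBasis m where
  toFun z := (fun i => z (Fin.natAdd 0 (Fin.castAdd m i)), fun i => z (Fin.natAdd 0 (Fin.natAdd n i)))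
  invFun p i := Fin.append p.1 p.2 (Fin.cast (zero_add _) i)
  left_inv z := by
    funext i
    obtain ⟨i, rfl⟩ : ∃ j, i = Fin.natAdd 0 j := ⟨Fin.cast (zero_add _) i, by ext; simp⟩
    have h : Fin.cast (zero_add (n + m)) (Fin.natAdd 0 i) = i := by ext; simp
    dsimp only
    rw [h]
    refine Fin.addCases (fun j => ?_) (fun j => ?_) i
    · rw [Fin.append_left]
    · rw [Fin.append_right]
  right_inv p := by
    ext i <;> simp

/-- The basis states of `0 + n` qubits. -/
def zeroAddQBasis (n : ℕ) : QBasis (0 + n) ≃ QBasis n where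
  toFun z i := z (Fin.natAdd 0 i)
  invFun y i := y (Fin.cast (zero_add _) i)
  left_inv z := by
    funext i
    exact congrArg z (by ext; simp)
  right_inv y := by
    funext i
    exact congrArg y (by ext; simp)

theorem IsStarProjection.submatrix_equiv {α β : Type*} [Fintype α] [Fintype β] [DecidableEq α]
    [DecidableEq β] {M : Matrix α α ℂ} (hM : IsStarProjection M) (e : β ≃ α) :
    IsStarProjection (M.submatrix e e) := by
  refine ⟨?_, ?_⟩
  · rw [IsIdempotentElem, Matrix.submatrix_mul_equiv, hM.isIdempotentElem.eq]
  · rw [isSelfAdjoint_iff, Matrix.star_eq_conjTranspose, Matrix.conjTranspose_submatrix,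
      ← Matrix.star_eq_conjTranspose, hM.isSelfAdjoint.star_eq]

section TwoMessages

variable {U V : Type} {n m : ℕ} (φ : U → QBasis n → ℂ) (hφ : ∀ u, ∑ x, star (φ u x) * φ u x = 1)
  (θ : V → QBasis n → ℂ) (hθ : ∀ v x, star (θ v x) * θ v x = 1) (μ : V → QBasis m)
  (M : U → Matrix (QBasis n × QBasis m) (QBasis n × QBasis m) ℂ) (hM : ∀ u, IsStarProjection (M u))

/-- Alice sends the state `φ u`; Bob multiplies the amplitude of each basis state `x` by the phase
`θ v x`, appends the classical message `μ v` and sends everything back; Alice measures `M u`. -/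
noncomputable def twoMessageProtocol : QuantumProtocol U V 0 0 :=
  .sendA 0 n (fun u => Matrix.of fun p _ => φ u p.2)
    (fun u => by
      ext i j
      rw [Subsingleton.elim j i, Matrix.mul_apply, Fintype.sum_prod_type, Fintype.sum_unique]
      simpa using hφ u) <|
  .sendB 0 (n + m)
    (fun v => Matrix.of fun p x =>
      if p.2 = Fin.append (zeroAddQBasis n x) (μ v) then θ v (zeroAddQBasis n x) else 0)
    (fun v => by
      ext x x'
      rw [Matrix.mul_apply, Fintype.sum_prod_type, Fintype.sum_unique]
      simp only [Matrix.conjTranspose_apply, Matrix.of_apply, mul_ite, mul_zero]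
      rw [Finset.sum_ite_eq' Finset.univ (Fin.append (zeroAddQBasis n x') (μ v)),
        if_pos (Finset.mem_univ _)]
      by_cases h : x' = x
      · subst h
        rw [if_pos rfl, Matrix.one_apply_eq, hθ]
      · rw [if_neg, star_zero, zero_mul, Matrix.one_apply_ne (Ne.symm h)]
        -- Bob returns `x` itself, so distinct basis states have images with disjoint supports.
        intro heq
        refine h ((zeroAddQBasis n).injective (funext fun i => ?_))
        simpa only [Fin.append_left] using congrFun heq (Fin.castAdd m i)) <|
  .outputA (fun u => (M u).submatrix (splitQBasis n m) (splitQBasis n m))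
    (fun u => (hM u).submatrix_equiv _)

theorem twoMessageProtocol_qubits :
    (twoMessageProtocol φ hφ θ hθ μ M hM).qubits = n + (n + m) := by
  simp [twoMessageProtocol, QuantumProtocol.qubits]

/-- The state that Alice measures. -/
noncomputable def twoMessageState (u : U) (v : V) : QBasis n × QBasis m → ℂ := fun p =>
  if p.2 = μ v then θ v p.1 * φ u p.1 else 0

theorem twoMessageProtocol_outputProb (o : Bool) (u : U) (v : V) :
    (twoMessageProtocol φ hφ θ hθ μ M hM).outputProb o u v (fun _ _ => 1) =
      ∑ p, ‖((if o then M u else 1 - M u) *ᵥ twoMessageState φ θ μ u v) p‖ ^ 2 := by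
  have hstate : ∀ a : QBasis (0 + (n + m)), (∑ b' : QBasis (0 + n),
      (if (fun i => a (Fin.natAdd 0 i)) = Fin.append (zeroAddQBasis n b') (μ v)
        then θ v (zeroAddQBasis n b') else 0) * φ u (zeroAddQBasis n b')) =
      twoMessageState φ θ μ u v (splitQBasis n m a) := by
    intro a
    rw [(zeroAddQBasis n).sum_comp (fun x : QBasis n =>
      (if (fun i => a (Fin.natAdd 0 i)) = Fin.append x (μ v) then θ v x else 0) * φ u x)]
    have hiff : ∀ x, (fun i => a (Fin.natAdd 0 i)) = Fin.append x (μ v) ↔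
        x = (splitQBasis n m a).1 ∧ (splitQBasis n m a).2 = μ v := by
      intro x
      constructor
      · intro h
        constructor
        · funext i
          exact ((congrFun h (Fin.castAdd m i)).trans (Fin.append_left _ _ _)).symm
        · funext i
          exact (congrFun h (Fin.natAdd n i)).trans (Fin.append_right _ _ _)
      · rintro ⟨rfl, h⟩
        rw [← h]
        funext i
        refine Fin.addCases (fun j => ?_) (fun j => ?_) i <;> simp [splitQBasis]
    simp only [hiff, twoMessageState]
    rw [Finset.sum_eq_single (splitQBasis n m a).1]
    · by_cases h : (splitQBasis n m a).2 = μ v <;> simp [h]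
    · intro x _ hx
      simp [hx]
    · simp
  have hout : QuantumProtocol.outcome ((M u).submatrix (splitQBasis n m) (splitQBasis n m)) o =
      (if o then M u else 1 - M u).submatrix (splitQBasis n m) (splitQBasis n m) := by
    cases o
    · simp [QuantumProtocol.outcome, Matrix.submatrix_sub, Matrix.submatrix_one_equiv]
    · simp [QuantumProtocol.outcome]
  simp only [twoMessageProtocol, QuantumProtocol.outputProb, Matrix.of_apply, Fintype.sum_unique,
    mul_one]
  rw [← (splitQBasis n m).sum_comp]
  refine Finset.sum_congr rfl fun a _ => ?_
  rw [hout]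
  congr 2
  rw [Matrix.mulVec, dotProduct, ← (splitQBasis n m).sum_comp]
  refine Finset.sum_congr rfl fun a' _ => ?_
  rw [← hstate]
  rfl

end TwoMessages

theorem sum_norm_sq_twoMessageState {U V : Type} {n m : ℕ} {φ : U → QBasis n → ℂ}
    (hφ : ∀ u, ∑ x, star (φ u x) * φ u x = 1) {θ : V → QBasis n → ℂ}
    (hθ : ∀ v x, star (θ v x) * θ v x = 1) (μ : V → QBasis m) (u : U) (v : V) :
    ∑ p, ‖twoMessageState φ θ μ u v p‖ ^ 2 = 1 := by
  have key : ∀ z : ℂ, star z * z = ((‖z‖ ^ 2 : ℝ) : ℂ) := fun z => by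
    simpa using Complex.conj_mul' z
  have hθ' : ∀ x, ‖θ v x‖ ^ 2 = 1 := fun x => by exact_mod_cast (key _).symm.trans (hθ v x)
  have hφ' : ∑ x, ‖φ u x‖ ^ 2 = 1 := by
    have h := hφ u
    simp only [key] at h
    exact_mod_cast h
  rw [Fintype.sum_prod_type, ← hφ']
  refine Finset.sum_congr rfl fun x _ => ?_
  rw [Finset.sum_eq_single (μ v)]
  · simp [twoMessageState, mul_pow, hθ']
  · intro y _ hy
    simp [twoMessageState, hy]
  · simp

/-- The second register is in the basis state `μ v`, so only that column of `B` matters. -/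
theorem kronecker_mulVec_twoMessageState {U V : Type} {n m : ℕ} (φ : U → QBasis n → ℂ)
    (θ : V → QBasis n → ℂ) (μ : V → QBasis m) (u : U) (v : V)
    (A : Matrix (QBasis n) (QBasis n) ℂ) (B : Matrix (QBasis m) (QBasis m) ℂ)
    (p : QBasis n × QBasis m) :
    (Matrix.kroneckerMap (· * ·) A B *ᵥ twoMessageState φ θ μ u v) p =
      (∑ x, A p.1 x * (θ v x * φ u x)) * B p.2 (μ v) := by
  rw [Matrix.mulVec, dotProduct, Fintype.sum_prod_type, Finset.sum_mul]
  refine Finset.sum_congr rfl fun x _ => ?_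
  rw [Finset.sum_eq_single (μ v)]
  · simp only [Matrix.kroneckerMap_apply, twoMessageState, if_true]
    ring
  · intro y _ hy
    simp [twoMessageState, hy]
  · simp

theorem isStarProjection_kronecker {α β : Type*} [Fintype α] [Fintype β] [DecidableEq α]
    [DecidableEq β] {A : Matrix α α ℂ} {B : Matrix β β ℂ} (hA : IsStarProjection A)
    (hB : IsStarProjection B) : IsStarProjection (Matrix.kroneckerMap (· * ·) A B) := by
  refine ⟨?_, ?_⟩
  · rw [IsIdempotentElem, ← Matrix.mul_kronecker_mul, hA.isIdempotentElem.eq,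
      hB.isIdempotentElem.eq]
  · rw [isSelfAdjoint_iff, Matrix.star_eq_conjTranspose, Matrix.conjTranspose_kronecker,
      ← Matrix.star_eq_conjTranspose, ← Matrix.star_eq_conjTranspose, hA.isSelfAdjoint.star_eq,
      hB.isSelfAdjoint.star_eq]

theorem isStarProjection_vecMulVec {α : Type*} [Fintype α] [DecidableEq α] {φ : α → ℂ}
    (hφ : ∑ x, star (φ x) * φ x = 1) : IsStarProjection (Matrix.vecMulVec φ (star φ)) := by
  refine ⟨?_, ?_⟩
  · have h : star φ ⬝ᵥ φ = 1 := hφ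
    rw [IsIdempotentElem, Matrix.vecMulVec_mul_vecMulVec, h, one_smul]
  · rw [isSelfAdjoint_iff, Matrix.star_eq_conjTranspose, Matrix.conjTranspose_vecMulVec, star_star]

theorem isStarProjection_diagonal_indicator {α : Type*} [Fintype α] [DecidableEq α] (p : α → Prop)
    [DecidablePred p] :
    IsStarProjection (Matrix.diagonal fun x => if p x then (1 : ℂ) else 0) := by
  refine ⟨?_, ?_⟩
  · rw [IsIdempotentElem, Matrix.diagonal_mul_diagonal]
    congr 1
    funext x
    simp
  · rw [isSelfAdjoint_iff, Matrix.star_eq_conjTranspose, Matrix.diagonal_conjTranspose]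
    congr 1
    funext x
    by_cases h : p x <;> simp [h]

/-! ### Additivity and balance of Hadamard codewords -/

/-- The input, extended by the value `0` at the index `0`. -/
def extendInput {k k' : ℕ} (a : HEQInput k k') (i : Fin (2 ^ k)) : Fin (2 ^ k') :=
  if h : (i : ℕ) = 0 then 0 else a ⟨i, h⟩

theorem deltaVector_apply {k k' : ℕ} (a b : HEQInput k k') (i : Fin (2 ^ k)) :
    deltaVector a b i = if extendInput a i = extendInput b i then 0 else 1 := by
  by_cases h : (i : ℕ) = 0 <;> simp [deltaVector, extendInput, h]

/-- The binary encoding of `i < 2 ^ k`. -/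
noncomputable def binaryEncoding (k : ℕ) : Fin (2 ^ k) ≃ (Fin k → ZMod 2) :=
  Equiv.ofBijective (fun i j => if (i : ℕ).testBit j then 1 else 0) <| by
    rw [Fintype.bijective_iff_injective_and_card]
    refine ⟨fun i i' h => Fin.ext (Nat.eq_of_testBit_eq fun j => ?_), by simp [ZMod.card]⟩
    by_cases hj : j < k
    · have := congrFun h ⟨j, hj⟩
      by_cases h₁ : (i : ℕ).testBit j <;> by_cases h₂ : (i' : ℕ).testBit j <;> simp_all
    · have hpow : 2 ^ k ≤ 2 ^ j := Nat.pow_le_pow_right (by norm_num) (not_lt.1 hj)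
      rw [Nat.testBit_lt_two_pow (i.2.trans_le hpow), Nat.testBit_lt_two_pow (i'.2.trans_le hpow)]

theorem bitInner_eq_dotProduct {k : ℕ} (w : Fin k → ZMod 2) (i : Fin (2 ^ k)) :
    bitInner w i = w ⬝ᵥ binaryEncoding k i := rfl

/-- An additive map to `F_2` is linear, hence the inner product with its vector of values on the
standard basis. Thus non-membership is witnessed by three coordinates. -/
theorem mem_hadamardCode_iff_additive {k : ℕ} (d : Fin (2 ^ k) → ZMod 2) :
    d ∈ hadamardCode k ↔ ∀ x y, d ((binaryEncoding k).symm (x + y)) =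
      d ((binaryEncoding k).symm x) + d ((binaryEncoding k).symm y) := by
  rw [mem_hadamardCode_iff]
  constructor
  · rintro ⟨w, hw⟩ x y
    simp only [← hw, bitInner_eq_dotProduct, Equiv.apply_symm_apply, dotProduct_add]
  · intro h
    let f : (Fin k → ZMod 2) →+ ZMod 2 := AddMonoidHom.mk' (fun x => d ((binaryEncoding k).symm x)) h
    refine ⟨fun j => f (Pi.single j 1), fun i => ?_⟩
    have := LinearMap.pi_apply_eq_sum_univ (f.toZModLinearMap 2) (binaryEncoding k i)
    have hf : f (binaryEncoding k i) = d i := by simp [f]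
    rw [← hf, bitInner_eq_dotProduct, dotProduct]
    refine Eq.trans ?_ this.symm
    refine Finset.sum_congr rfl fun j _ => ?_
    rw [smul_eq_mul, mul_comm]
    refine congrArg (_ * ·) (congrArg f (funext fun j' => ?_))
    simp [Pi.single_apply, eq_comm]

/-- Nonzero Hadamard codewords are balanced. -/
theorem sum_sign_deltaVector_eq_zero {k : ℕ} {d : Fin (2 ^ k) → ZMod 2} (hd : d ∈ hadamardCode k)
    (h0 : d ≠ 0) : ∑ i, (if d i = 0 then (1 : ℂ) else -1) = 0 := by
  rw [mem_hadamardCode_iff_additive] at hd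
  obtain ⟨i, hi⟩ := Function.ne_iff.1 h0
  set g : (Fin k → ZMod 2) → ℂ := fun x => if d ((binaryEncoding k).symm x) = 0 then 1 else -1
    with hg
  have h1 : ∑ i, (if d i = 0 then (1 : ℂ) else -1) = ∑ x, g x :=
    ((binaryEncoding k).symm.sum_comp fun i => if d i = 0 then (1 : ℂ) else -1).symm
  -- Translation by a point where the codeword is 1 flips every sign.
  have h2 : ∑ x, g x = ∑ x, -g x := by
    rw [← Equiv.sum_comp (Equiv.addRight (binaryEncoding k i)) g]
    refine Finset.sum_congr rfl fun x _ => ?_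
    simp only [hg, Equiv.coe_addRight, hd, Equiv.symm_apply_apply]
    generalize d ((binaryEncoding k).symm x) = t
    have hi' : d i = 1 := by
      rw [Pi.zero_apply] at hi
      generalize d i = t at hi
      revert t; decide
    rw [hi']
    have ht : (t + 1 = 0) ↔ ¬ t = 0 := by revert t; decide
    by_cases h : t = 0 <;> simp [ht, h]
  rw [h1]
  rw [Finset.sum_neg_distrib] at h2
  exact self_eq_neg.1 h2

/-! ### The quantum protocol for Hadamard Equality -/

namespace HEQProtocol

/-- `3 * k` qubits hold an index and an entry. -/
noncomputable def entryRegister (k : ℕ) :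
    QBasis (3 * k) ≃ Fin (2 ^ k) × Fin (2 ^ (2 * k)) :=
  Fintype.equivOfCardEq (by simp [← pow_add]; ring)

/-- The messages in which Bob reveals three of his entries. -/
abbrev Reveal (k : ℕ) : Type :=
  ((Fin k → ZMod 2) × (Fin k → ZMod 2)) × Fin (2 ^ (2 * k)) × Fin (2 ^ (2 * k)) × Fin (2 ^ (2 * k))

/-- `8 * k` qubits hold two indices and three entries. -/
noncomputable def revealRegister (k : ℕ) : QBasis (8 * k) ≃ Reveal k :=
  Fintype.equivOfCardEq (by simp [← pow_add, ZMod.card]; ring)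

/-- Alice's initial state: a uniform superposition of the indices together with her entries. -/
noncomputable def superposition {k : ℕ} (a : HEQInput k (2 * k)) (x : QBasis (3 * k)) : ℂ :=
  if (entryRegister k x).2 = extendInput a (entryRegister k x).1
    then (((√(2 ^ k))⁻¹ : ℝ) : ℂ) else 0

/-- Bob's phase: a sign change if the entry differs from his. -/
noncomputable def comparePhase {k : ℕ} (b : HEQInput k (2 * k)) (x : QBasis (3 * k)) : ℂ :=
  if (entryRegister k x).2 = extendInput b (entryRegister k x).1 then 1 else -1

/-- Bob's message, which reveals his entries at `x`, `y` and `x + y`. -/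
noncomputable def revealMessage {k : ℕ} (b : HEQInput k (2 * k))
    (p : (Fin k → ZMod 2) × (Fin k → ZMod 2)) : QBasis (8 * k) :=
  (revealRegister k).symm (p, extendInput b ((binaryEncoding k).symm p.1),
    extendInput b ((binaryEncoding k).symm p.2), extendInput b ((binaryEncoding k).symm (p.1 + p.2)))

/-- The entries that Bob revealed show that the vector of differences is not a codeword. -/
def Refutes {k : ℕ} (a : HEQInput k (2 * k)) (z : Reveal k) : Prop :=
  (if extendInput a ((binaryEncoding k).symm (z.1.1 + z.1.2)) = z.2.2.2 then (0 : ZMod 2) else 1) ≠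
    (if extendInput a ((binaryEncoding k).symm z.1.1) = z.2.1 then 0 else 1) +
      (if extendInput a ((binaryEncoding k).symm z.1.2) = z.2.2.1 then 0 else 1)

theorem refutes_revealMessage_iff {k : ℕ} (a b : HEQInput k (2 * k))
    (p : (Fin k → ZMod 2) × (Fin k → ZMod 2)) :
    Refutes a (revealRegister k (revealMessage b p)) ↔
      deltaVector a b ((binaryEncoding k).symm (p.1 + p.2)) ≠
        deltaVector a b ((binaryEncoding k).symm p.1) +
          deltaVector a b ((binaryEncoding k).symm p.2) := by
  simp only [Refutes, revealMessage, Equiv.apply_symm_apply, deltaVector_apply]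

/-- A diagonal operator has as expectation in Alice's state the mean of its values at her
index-entry pairs. Constant `g` gives normalization; Bob's sign gives the overlap in the equality
test. -/
theorem sum_superposition {k : ℕ} (a : HEQInput k (2 * k))
    (g : Fin (2 ^ k) × Fin (2 ^ (2 * k)) → ℂ) :
    ∑ x, star (superposition a x) * (g (entryRegister k x) * superposition a x) =
      (2 ^ k : ℂ)⁻¹ * ∑ i, g (i, extendInput a i) := by
  have hs : (((√(2 ^ k))⁻¹ : ℝ) : ℂ) * (((√(2 ^ k))⁻¹ : ℝ) : ℂ) = (2 ^ k : ℂ)⁻¹ := by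
    rw [← Complex.ofReal_mul, ← mul_inv, Real.mul_self_sqrt (by positivity)]
    push_cast
    rfl
  have h1 : ∀ x, star (superposition a x) * (g (entryRegister k x) * superposition a x) =
      (fun p : Fin (2 ^ k) × Fin (2 ^ (2 * k)) =>
        if p.2 = extendInput a p.1 then (2 ^ k : ℂ)⁻¹ * g p else 0) (entryRegister k x) := by
    intro x
    dsimp only [superposition]
    split_ifs
    · rw [← hs, Complex.star_def, Complex.conj_ofReal]; ring
    · simp
  rw [Finset.sum_congr rfl fun x _ => h1 x, Equiv.sum_comp (entryRegister k) fun p =>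
      if p.2 = extendInput a p.1 then (2 ^ k : ℂ)⁻¹ * g p else 0,
    Fintype.sum_prod_type, Finset.mul_sum]
  simp

theorem superposition_norm {k : ℕ} (a : HEQInput k (2 * k)) :
    ∑ x, star (superposition a x) * superposition a x = 1 := by
  simpa using sum_superposition a fun _ => 1

theorem comparePhase_norm {k : ℕ} (b : HEQInput k (2 * k)) (x : QBasis (3 * k)) :
    star (comparePhase b x) * comparePhase b x = 1 := by
  unfold comparePhase
  split_ifs <;> simp

open Classical in
/-- Alice's measurement. With an empty proof she tests whether the first register is still in its
initial state; otherwise she checks the entries that Bob revealed. -/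
noncomputable def measurement {k : ℕ} (u : HEQInput k (2 * k) × List Bool) :
    Matrix (QBasis (3 * k) × QBasis (8 * k)) (QBasis (3 * k) × QBasis (8 * k)) ℂ :=
  if u.2 = [] then Matrix.kroneckerMap (· * ·)
    (Matrix.vecMulVec (superposition u.1) (star (superposition u.1))) 1
  else Matrix.kroneckerMap (· * ·) 1
    (Matrix.diagonal fun z => if Refutes u.1 (revealRegister k z) then (1 : ℂ) else 0)

theorem isStarProjection_measurement {k : ℕ} (u : HEQInput k (2 * k) × List Bool) :
    IsStarProjection (measurement u) := by
  classical
  unfold measurement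
  split_ifs
  · exact isStarProjection_kronecker (isStarProjection_vecMulVec (superposition_norm _)) (.one _)
  · exact isStarProjection_kronecker (.one _) (isStarProjection_diagonal_indicator _)

/-- The interpretation of Bob's proof as a pair of indices. -/
noncomputable def decode (k : ℕ) : List Bool → (Fin k → ZMod 2) × (Fin k → ZMod 2) :=
  Function.invFun fun p => Infinite.natEmbedding (List Bool)
    (Fintype.equivFin ((Fin k → ZMod 2) × (Fin k → ZMod 2)) p)

/-- Completeness needs every pair to have a string. Strings outside the image of the embedding
decode to an unspecified pair, which is harmless because soundness holds for all pairs. -/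
theorem decode_surjective (k : ℕ) : Function.Surjective (decode k) :=
  Function.invFun_surjective fun _ _ h => (Fintype.equivFin _).injective
    (Fin.ext ((Infinite.natEmbedding (List Bool)).injective h))

/-- The state that Alice measures. -/
noncomputable def finalState {k : ℕ} (u v : HEQInput k (2 * k) × List Bool) :
    QBasis (3 * k) × QBasis (8 * k) → ℂ :=
  twoMessageState (fun u => superposition u.1) (fun v => comparePhase v.1)
    (fun v : HEQInput k (2 * k) × List Bool => revealMessage v.1 (decode k v.2)) u v

/-- The quantum protocol for Hadamard Equality. -/
noncomputable def protocol (k : ℕ) : QuantumProofProtocol (HEQInput k (2 * k)) (HEQInput k (2 * k)) :=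
  twoMessageProtocol (fun u => superposition u.1) (fun u => superposition_norm u.1)
    (fun v => comparePhase v.1) (fun v => comparePhase_norm v.1)
    (fun v => revealMessage v.1 (decode k v.2)) measurement isStarProjection_measurement

theorem prob_protocol {k : ℕ} (o : Bool) (x y : HEQInput k (2 * k)) (r s : List Bool) :
    (protocol k).prob o x y r s = ∑ p,
      ‖((if o then measurement (x, r) else 1 - measurement (x, r)) *ᵥ
        finalState (x, r) (y, s)) p‖ ^ 2 :=
  twoMessageProtocol_outputProb ..

theorem sum_norm_sq_finalState {k : ℕ} (u v : HEQInput k (2 * k) × List Bool) :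
    ∑ p, ‖finalState u v p‖ ^ 2 = 1 :=
  sum_norm_sq_twoMessageState (φ := fun u : HEQInput k (2 * k) × List Bool => superposition u.1)
    (θ := fun v : HEQInput k (2 * k) × List Bool => comparePhase v.1)
    (fun u => superposition_norm u.1) (fun v => comparePhase_norm v.1)
    (fun v => revealMessage v.1 (decode k v.2)) u v

theorem prob_true_eq_one {k : ℕ} {x y : HEQInput k (2 * k)} {r s : List Bool}
    (h : measurement (x, r) *ᵥ finalState (x, r) (y, s) = finalState (x, r) (y, s)) :
    (protocol k).prob true x y r s = 1 := by
  rw [prob_protocol, if_pos rfl, h, sum_norm_sq_finalState]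

theorem prob_false_eq_one {k : ℕ} {x y : HEQInput k (2 * k)} {r s : List Bool}
    (h : measurement (x, r) *ᵥ finalState (x, r) (y, s) = 0) :
    (protocol k).prob false x y r s = 1 := by
  rw [prob_protocol, if_neg (by simp), Matrix.sub_mulVec, h, Matrix.one_mulVec, sub_zero,
    sum_norm_sq_finalState]

-- Bob's message is a basis state, so the diagonal projection either keeps the whole state or kills
-- it; this test is deterministic.
open Classical in
theorem measurement_mulVec_of_ne_nil {k : ℕ} (a b : HEQInput k (2 * k)) {r : List Bool}
    (hr : r ≠ []) (s : List Bool) :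
    measurement (a, r) *ᵥ finalState (a, r) (b, s) =
      if Refutes a (revealRegister k (revealMessage b (decode k s)))
        then finalState (a, r) (b, s) else 0 := by
  funext p
  rw [measurement, if_neg hr, finalState, kronecker_mulVec_twoMessageState]
  by_cases hp : p.2 = revealMessage b (decode k s)
  · split_ifs with h <;> simp [twoMessageState, hp, h, Matrix.one_apply]
  · split_ifs with h <;> simp [twoMessageState, hp, Matrix.diagonal_apply_ne]

/-- The middle factor is the inner product of the original and the returned state: 1 for equal
inputs, 0 for nonzero codewords. -/
theorem measurement_mulVec_nil {k : ℕ} (a b : HEQInput k (2 * k)) (s : List Bool)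
    (p : QBasis (3 * k) × QBasis (8 * k)) :
    (measurement (a, []) *ᵥ finalState (a, []) (b, s)) p =
      superposition a p.1 * ((2 ^ k : ℂ)⁻¹ * ∑ i, if deltaVector a b i = 0 then 1 else -1) *
        (1 : Matrix (QBasis (8 * k)) (QBasis (8 * k)) ℂ) p.2 (revealMessage b (decode k s)) := by
  have hsum : ∑ i, (if deltaVector a b i = 0 then (1 : ℂ) else -1) =
      ∑ i, if extendInput a i = extendInput b i then 1 else -1 :=
    Finset.sum_congr rfl fun i _ => by rw [deltaVector_apply]; split_ifs <;> simp_all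
  rw [hsum, ← sum_superposition a fun q => if q.2 = extendInput b q.1 then 1 else -1, measurement,
    if_pos rfl, finalState, kronecker_mulVec_twoMessageState, Finset.mul_sum]
  simp only [Matrix.vecMulVec_apply, Pi.star_apply, comparePhase, mul_assoc]

theorem protocol_computes (k : ℕ) : (protocol k).Computes (HEQ k (2 * k)) := by
  classical
  intro a b
  constructor
  · intro hf
    by_cases hmem : deltaVector a b ∈ hadamardCode k
    · have hd : deltaVector a b = 0 := by
        by_contra h
        rw [(HEQ_eq_false_iff a b).2 ⟨hmem, h⟩] at hf
        cases hf
      obtain rfl := (deltaVector_eq_zero_iff a b).1 hd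
      refine ⟨[], [], prob_true_eq_one (funext fun ⟨x, z⟩ => ?_)⟩
      rw [measurement_mulVec_nil, hd, finalState, twoMessageState]
      -- On the support of the superposition the entry is Bob's own, so the phase is 1.
      have h1 : comparePhase a x * superposition a x = superposition a x := by
        unfold comparePhase superposition
        split_ifs <;> simp
      by_cases hz : z = revealMessage a (decode k [])
      · subst hz
        simp [h1]
      · simp [hz]
    · rw [mem_hadamardCode_iff_additive] at hmem
      push Not at hmem
      obtain ⟨x, y, hxy⟩ := hmem
      obtain ⟨s, hs⟩ := decode_surjective k (x, y)
      refine ⟨[true], s, prob_true_eq_one ?_⟩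
      rw [measurement_mulVec_of_ne_nil _ _ (by simp), if_pos]
      rwa [refutes_revealMessage_iff, hs]
  · intro hf r s
    obtain ⟨hmem, hne⟩ := (HEQ_eq_false_iff a b).1 hf
    refine prob_false_eq_one ?_
    rcases eq_or_ne r [] with rfl | hr
    · funext p
      rw [measurement_mulVec_nil, sum_sign_deltaVector_eq_zero hmem hne]
      simp
    · rw [measurement_mulVec_of_ne_nil _ _ hr, if_neg]
      rw [refutes_revealMessage_iff, not_not]
      exact (mem_hadamardCode_iff_additive _).1 hmem _ _

end HEQProtocol

/-! ### Conclusion -/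

theorem quantumWeakNondetCC_HEQ_le (k : ℕ) :
    quantumWeakNondetCC (HEQ k (2 * k)) ≤ ((14 * k : ℕ) : ℕ∞) := by
  refine (iInf₂_le (HEQProtocol.protocol k) (HEQProtocol.protocol_computes k)).trans ?_
  rw [HEQProtocol.protocol, twoMessageProtocol_qubits, Nat.cast_le]
  omega

theorem mainTheorem4 :
    (∀ k : ℕ, 1 ≤ k →
      quantumWeakNondetCC (HEQ k (2 * k)) ≠ ⊤ ∧ nondetCC (HEQ k (2 * k)) ≠ ⊤) ∧
    (fun k : ℕ => ((quantumWeakNondetCC (HEQ k (2 * k))).toNat : ℝ)) =O[atTop]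
      (fun k : ℕ => (k : ℝ)) ∧
    (fun k : ℕ => (k : ℝ) ^ 2) =O[atTop]
      (fun k : ℕ => ((nondetCC (HEQ k (2 * k))).toNat : ℝ)) ∧
    (fun k : ℕ => ((quantumWeakNondetCC (HEQ k (2 * k))).toNat : ℝ) ^ 2) =O[atTop]
      (fun k : ℕ => ((nondetCC (HEQ k (2 * k))).toNat : ℝ)) := by
  have hQ : (fun k : ℕ => ((quantumWeakNondetCC (HEQ k (2 * k))).toNat : ℝ)) =O[atTop]
      (fun k : ℕ => (k : ℝ)) := by
    refine IsBigO.of_bound 14 (Eventually.of_forall fun k => ?_)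
    have h := ENat.toNat_le_toNat (quantumWeakNondetCC_HEQ_le k) (ENat.natCast_ne_top _)
    rw [ENat.toNat_natCast] at h
    simp only [RCLike.norm_natCast]
    exact_mod_cast h
  have hN : (fun k : ℕ => (k : ℝ) ^ 2) =O[atTop]
      (fun k : ℕ => ((nondetCC (HEQ k (2 * k))).toNat : ℝ)) := by
    refine IsBigO.of_bound 1 (Eventually.of_forall fun k => ?_)
    -- `toNat` sends `⊤` to 0, so the lower bound passes to real numbers only because the complexity
    -- is finite.
    have h := ENat.toNat_le_toNat (sq_le_nondetCC_HEQ k) (nondetCC_ne_top _)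
    rw [ENat.toNat_natCast] at h
    simp only [norm_pow, RCLike.norm_natCast, one_mul]
    exact_mod_cast h
  exact ⟨fun k _ => ⟨ne_top_of_le_ne_top (ENat.natCast_ne_top _) (quantumWeakNondetCC_HEQ_le k),
    nondetCC_ne_top _⟩, hQ, hN, (hQ.pow 2).trans hN⟩
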